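/- All graphs and tournaments are finite. A \emph{3ECTF graph} is a finite triangle-free graph $G$ that is $3$-existentially complete: whenever $B\subseteq A\subseteq V(G)$, $|A|\le 3$ and $B$ is independent, there is a vertex adjacent to every vertex of $B$ and to no vertex of $A\setminus B$. A \emph{tournament} $T$ is an orientation of a complete graph; write $i\to i'$ for its arcs. Let $T_4$ be the tournament on $\{0,1,2,3\}$ with arcs $0\to1$, $0\to2$, $0\to3$, $1\to2$, $2\to3$, $3\to1$, and let $T_4'$ be obtained from $T_4$ by reversing all arcs. $T$ is \emph{shattered} if every three distinct vertices of $T$ lie in a four-vertex set that induces a copy of $T_4$ or of $T_4'$. Let $d$ be the Hamming distance on $\mathbb{Z}_2^n$, and for $n\ge2$ let $\tau(x_1,x_2,x_3,\dots,x_n)=(x_2,x_1+1,x_3,\dots,x_n)$. For $m,k\ge1$, let $C_{3k-1}(m)$ be the graph with vertices $(j,x)$, $1\le j\le m$, $x\in\mathbb{Z}_2^{3k-1}$, in which $(j,x)\sim(j,x')$ if and only if $d(x,x')\in\{2k-1,2k+1,2k+2,\dots,3k-1\}$, and, for $j\ne j'$, $(j,x)\sim(j',x')$ if and only if $d(x,x')\in\{2k,2k+1,\dots,3k-1\}$.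 For a tournament $T$, the twisted graph $G_T(m,k)$ has vertices $(i,j,x)$ with $i\in V(T)$, $1\le j\le m$, $x\in\mathbb{Z}_2^{3k-1}$. For each $i$, $(i,j,x)\sim(i,j',x')$ if and only if $(j,x)\sim(j',x')$ in $C_{3k-1}(m)$; and if $i\to i'$, then for all $j,j'$, $(i,j,x)\sim(i',j',x')$ if and only if $d(x,\tau(x'))\in\{2k,2k+1,\dots,3k-1\}$. \textbf{Proposition.} Let $m\ge2$ and $k\ge1$, and let $T$ be a shattered tournament with $|V(T)|\cdot m\ge4$ (since $m\ge 2$, this holds whenever $T$ has at least two vertices; it only excludes the empty tournament and, for $m\in\{2,3\}$, the one-vertex tournament). Then $G_T(m,k)$ is a 3ECTF graph. -/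

import Mathlib

/-- A tournament on `V`: an orientation of the complete graph on `V`.
`T.Adj i j` is the arc `i → j`. -/
structure Tournament (V : Type*) extends Digraph V where
  irrefl : ∀ i, ¬ Adj i i
  exactlyOne : ∀ i j, i ≠ j → (Adj i j ↔ ¬ Adj j i)

namespace Tournament

/-- The tournament obtained by reversing all arcs. -/
def reverse {V : Type*} (T : Tournament V) : Tournament V where
  Adj i j := T.Adj j i
  irrefl := T.irrefl
  exactlyOne i j h := T.exactlyOne j i h.symm

/-- The tournament `T₄` on `{0, 1, 2, 3}`: `0` beats the cyclic triangle `1 → 2 → 3 → 1`. -/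
def T4 : Tournament (Fin 4) where
  Adj i j := (i, j) ∈ ({(0, 1), (0, 2), (0, 3), (1, 2), (2, 3), (3, 1)} : Finset (Fin 4 × Fin 4))
  irrefl := by decide
  exactlyOne := by decide

/-- The tournament `T₄'`, obtained from `T₄` by reversing all arcs. -/
def T4' : Tournament (Fin 4) := T4.reverse

/-- `f` embeds `S` as an induced subtournament of `T`, i.e. its image is a copy of `S` in `T`. -/
def IsCopy {W V : Type*} (S : Tournament W) (T : Tournament V) (f : W ↪ V) : Prop :=
  ∀ a b, T.Adj (f a) (f b) ↔ S.Adj a b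

/-- Every three (distinct) vertices extend to a copy of `T₄` or of `T₄'`. -/
def IsShattered {V : Type*} (T : Tournament V) : Prop :=
  ∀ a b c : V, a ≠ b → a ≠ c → b ≠ c →
    ∃ f : Fin 4 ↪ V, (T4.IsCopy T f ∨ T4'.IsCopy T f) ∧
      a ∈ Set.range f ∧ b ∈ Set.range f ∧ c ∈ Set.range f

end Tournament

/-- `(E_k)`, `k`-existential completeness of a (triangle-free) graph: for all `B ⊆ A` with
`|A| ≤ k` and `B` independent, some vertex is adjacent to each vertex of `B` and to no vertex
of `A \ B`. -/
def SimpleGraph.IsExistentiallyComplete {V : Type*} (G : SimpleGraph V) (k : ℕ) : Prop :=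
  ∀ A B : Finset V, B ⊆ A → A.card ≤ k → G.IsIndepSet (B : Set V) →
    ∃ v, (∀ b ∈ B, G.Adj v b) ∧ ∀ a ∈ A, a ∉ B → ¬ G.Adj v a

/-- A 3ECTF graph: a finite `3`-existentially complete triangle-free graph. -/
structure SimpleGraph.Is3ECTF {V : Type*} (G : SimpleGraph V) : Prop where
  finite : Finite V
  triangleFree : G.CliqueFree 3
  existentiallyComplete : G.IsExistentiallyComplete 3

/-- The graph `C_{3k-1}(m)`: its vertices `(j, x)` form `m` copies of the cube `ℤ₂^{3k-1}`.
Within one copy, vertices are adjacent iff their Hamming distance is in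
`{2k-1, 2k+1, 2k+2, …, 3k-1}`; in different copies, iff it is in `{2k, 2k+1, …, 3k-1}`. -/
def hypercubeGraph (m k : ℕ) (hk : 1 ≤ k) :
    SimpleGraph (Fin m × (Fin (3 * k - 1) → ZMod 2)) where
  Adj p q :=
    (p.1 = q.1 ∧ hammingDist p.2 q.2 ∈ insert (2 * k - 1) (Finset.Icc (2 * k + 1) (3 * k - 1))) ∨
    (p.1 ≠ q.1 ∧ hammingDist p.2 q.2 ∈ Finset.Icc (2 * k) (3 * k - 1))
  symm := ⟨by
    intro p q h
    rw [hammingDist_comm q.2 p.2]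
    exact h.imp (fun h => ⟨h.1.symm, h.2⟩) (fun h => ⟨h.1.symm, h.2⟩)⟩
  loopless := ⟨by
    intro p h
    rcases h with ⟨-, h⟩ | ⟨h, -⟩
    · rw [hammingDist_self, Finset.mem_insert, Finset.mem_Icc] at h
      omega
    · exact h rfl⟩

/-- The twist `τ(x₁, x₂, x₃, …, xₙ) = (x₂, x₁ + 1, x₃, …, xₙ)` of `ℤ₂ⁿ`, `n ≥ 2`. -/
def twist {n : ℕ} (hn : 2 ≤ n) (x : Fin n → ZMod 2) : Fin n → ZMod 2 := fun i =>
  if i.val = 0 then x ⟨1, by omega⟩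
  else if i.val = 1 then x ⟨0, by omega⟩ + 1
  else x i

/-- The graph `G_T(m, k)`: its vertices are the `(i, j, x)` with `i` a vertex of `T`,
`j` one of `m` indices and `x ∈ ℤ₂^{3k-1}`. Each part `{i} × _ × _` is a copy of `C_{3k-1}(m)`,
and for `i → i'` the vertices `(i, j, x)`, `(i', j', x')` are adjacent iff
`d(x, τ(x')) ∈ {2k, …, 3k-1}`. -/
def twistedGraph {V : Type*} (T : Tournament V) (m k : ℕ) (hk : 1 ≤ k) :
    SimpleGraph (V × Fin m × (Fin (3 * k - 1) → ZMod 2)) where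
  Adj p q :=
    (p.1 = q.1 ∧ (hypercubeGraph m k hk).Adj p.2 q.2) ∨
    (T.Adj p.1 q.1 ∧
      hammingDist p.2.2 (twist (by omega) q.2.2) ∈ Finset.Icc (2 * k) (3 * k - 1)) ∨
    (T.Adj q.1 p.1 ∧
      hammingDist q.2.2 (twist (by omega) p.2.2) ∈ Finset.Icc (2 * k) (3 * k - 1))
  symm := ⟨by
    intro p q h
    rcases h with h | h | h
    · exact Or.inl ⟨h.1.symm, h.2.symm⟩
    · exact Or.inr (Or.inr h)
    · exact Or.inr (Or.inl h)⟩
  loopless := ⟨by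
    intro p h
    rcases h with h | h | h
    · exact (hypercubeGraph m k hk).irrefl h.2
    · exact T.irrefl _ h.1
    · exact T.irrefl _ h.1⟩

/-!
On the first two coordinates, which form a 4-cycle, the twist is a quarter turn, and it fixes the
others. So the distance of two vertices is the length of an arc of the 4-cycle plus a distance that
is left alone by the twist. Seen from the part over a vertex `c` of the tournament, every other part
is turned by a quarter, one way or the other, and adjacency to a vertex over `c` is read off from
the distance in this view. The view from either of two vertices of the tournament untwists the parts
over both of them, so three vertices of the graph that lie over at most two vertices of the
tournament are dealt with in an untwisted graph.

Prescribed adjacencies to three vertices over different vertices of the tournament can be met from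
one of their parts if the other two vertices do not obstruct each other in its view. Otherwise each
pair is obstructed in the view of the third part, and then no pair is obstructed in the view of the
fourth vertex of a copy of `T₄` or `T₄'`: the two views of a pair differ by a half turn, which swaps
arcs of length 0 and 2, and a parity argument excludes arcs of length 1.
-/

section Counting

open Finset

variable {ι κ : Type*}

theorem exists_finset_card_fiber_eq [Fintype ι] [DecidableEq κ] (f : ι → κ) (t : κ → ℕ)
    (ht : ∀ c, t c ≤ #{i | f i = c}) : ∃ S : Finset ι, ∀ c, #{i ∈ S | f i = c} = t c := by
  classical
  choose P hP hcard using fun c => exists_subset_card_eq (ht c)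
  refine ⟨univ.filter fun i => i ∈ P (f i), fun c => ?_⟩
  rw [← hcard c, filter_filter]
  congr 1
  ext i
  have hfi : i ∈ P c → f i = c := fun hi => by simpa using hP c hi
  grind

theorem card_filter_comp_eq_sum_card_fiber [Fintype κ] [DecidableEq κ] (s : Finset ι) (f : ι → κ)
    (g : κ → Prop) [DecidablePred g] : #{i ∈ s | g (f i)} = ∑ c with g c, #{i ∈ s | f i = c} := by
  rw [card_eq_sum_card_fiberwise (f := f) (t := {c | g c}) fun i hi => by simp_all]
  refine sum_congr rfl fun c hc => ?_
  rw [filter_filter]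
  congr 1
  ext i
  grind

theorem hammingDist_add_indicator [Fintype ι] [DecidableEq ι] (S : Finset ι) (x y : ι → ZMod 2) :
    hammingDist (fun i => if i ∈ S then x i + 1 else x i) y + #{i ∈ S | x i ≠ y i} =
      hammingDist x y + #{i ∈ S | x i = y i} := by
  have add_one_eq_iff : ∀ s t : ZMod 2, s + 1 = t ↔ s ≠ t := by decide
  have card_filter_mem (q : ι → Prop) [DecidablePred q] :
      #{i ∈ S | q i} = ∑ i, if i ∈ S ∧ q i then 1 else 0 := by
    rw [← card_filter, ← filter_filter, filter_univ_mem]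
  rw [hammingDist, hammingDist, card_filter_mem, card_filter_mem, card_filter, card_filter,
    ← sum_add_distrib, ← sum_add_distrib]
  refine sum_congr rfl fun i _ => ?_
  have := add_one_eq_iff (x i) (y i)
  split_ifs <;> grind

section Disagreement

variable (x y z : ι → ZMod 2)

/-- Whether `x` differs from `y` and whether it differs from `z` at a coordinate. -/
def disagreement (i : ι) : Bool × Bool :=
  (x i ≠ y i, x i ≠ z i)

/-- The number of coordinates in `S` at which the disagreement is `(s, t)`. -/
def disagreementCard (S : Finset ι) (s t : Bool) : ℕ :=
  #{i ∈ S | disagreement x y z i = (s, t)}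

theorem card_filter_disagreement (S : Finset ι) (g : Bool × Bool → Prop) [DecidablePred g] :
    #{i ∈ S | g (disagreement x y z i)} = ∑ c with g c, disagreementCard x y z S c.1 c.2 :=
  card_filter_comp_eq_sum_card_fiber S (disagreement x y z) g

theorem card_eq_sum_disagreementCard (S : Finset ι) :
    #S = disagreementCard x y z S true true + disagreementCard x y z S true false +
      (disagreementCard x y z S false true + disagreementCard x y z S false false) := by
  simpa [Fintype.sum_prod_type] using card_filter_disagreement x y z S fun _ => True

theorem card_filter_ne_left (S : Finset ι) : #{i ∈ S | x i ≠ y i} =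
    disagreementCard x y z S true true + disagreementCard x y z S true false := by
  simpa [sum_filter, Fintype.sum_prod_type, disagreement] using
    card_filter_disagreement x y z S (·.1)

theorem card_filter_ne_right (S : Finset ι) : #{i ∈ S | x i ≠ z i} =
    disagreementCard x y z S true true + disagreementCard x y z S false true := by
  simpa [sum_filter, Fintype.sum_prod_type, disagreement] using
    card_filter_disagreement x y z S (·.2)

theorem card_filter_eq_left (S : Finset ι) : #{i ∈ S | x i = y i} =
    disagreementCard x y z S false true + disagreementCard x y z S false false := by
  simpa [sum_filter, Fintype.sum_prod_type, disagreement] using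
    card_filter_disagreement x y z S (¬ ·.1)

theorem card_filter_eq_right (S : Finset ι) : #{i ∈ S | x i = z i} =
    disagreementCard x y z S true false + disagreementCard x y z S false false := by
  simpa [sum_filter, Fintype.sum_prod_type, disagreement] using
    card_filter_disagreement x y z S (¬ ·.2)

variable [Fintype ι]

theorem hammingDist_eq_disagreementCard : hammingDist y z =
    disagreementCard x y z univ true false + disagreementCard x y z univ false true := by
  have ne_iff : ∀ r s t : ZMod 2, s ≠ t ↔ decide (r ≠ s) ≠ decide (r ≠ t) := by decide
  have : hammingDist y z = #{i | (disagreement x y z i).1 ≠ (disagreement x y z i).2} :=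
    congrArg card (filter_congr fun i _ => ne_iff (x i) (y i) (z i))
  rw [this, card_filter_disagreement x y z univ fun c => c.1 ≠ c.2]
  simp [sum_filter, Fintype.sum_prod_type]

/-- Three points split the coordinates into four classes: `a`, `b`, `c` of them single out `x`, `y`
and `z` respectively, and at `p` of them all three agree. -/
theorem exists_hammingDist_triple :
    ∃ a b c p : ℕ, a + b + c + p = Fintype.card ι ∧ hammingDist x y = a + b ∧
      hammingDist x z = a + c ∧ hammingDist y z = b + c ∧
      ∀ a' ≤ a, ∀ b' ≤ b, ∀ c' ≤ c, ∀ p' ≤ p, ∃ v : ι → ZMod 2,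
        hammingDist v x = a' + b' + c' + p' ∧
        hammingDist v y = (a - a') + (b - b') + c' + p' ∧
        hammingDist v z = (a - a') + b' + (c - c') + p' := by
  classical
  set N := disagreementCard x y z with hN
  have dist_xy : hammingDist x y = N univ true true + N univ true false :=
    card_filter_ne_left x y z univ
  have dist_xz : hammingDist x z = N univ true true + N univ false true :=
    card_filter_ne_right x y z univ
  refine ⟨N univ true true, N univ true false, N univ false true, N univ false false,
    by rw [← card_univ, card_eq_sum_disagreementCard x y z]; ring, dist_xy, dist_xz,
    hammingDist_eq_disagreementCard x y z, fun a' ha b' hb c' hc p' hp => ?_⟩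
  obtain ⟨S, hS⟩ := exists_finset_card_fiber_eq (disagreement x y z)
    (fun | (true, true) => a' | (true, false) => b' | (false, true) => c' | (false, false) => p')
    (by rintro ⟨_ | _, _ | _⟩ <;> assumption)
  obtain rfl : N S true true = a' := hS _
  obtain rfl : N S true false = b' := hS _
  obtain rfl : N S false true = c' := hS _
  obtain rfl : N S false false = p' := hS _
  have flip_x := hammingDist_add_indicator S x x
  have flip_y := hammingDist_add_indicator S x y
  have flip_z := hammingDist_add_indicator S x z
  simp only [ne_eq, not_true_eq_false, filter_false, card_empty, add_zero, hammingDist_self,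
    filter_true, zero_add] at flip_x
  rw [card_eq_sum_disagreementCard x y z, ← hN] at flip_x
  rw [card_filter_ne_left x y z, card_filter_eq_left x y z, ← hN] at flip_y
  rw [card_filter_ne_right x y z, card_filter_eq_right x y z, ← hN] at flip_z
  exact ⟨_, by rw [flip_x]; ring, by omega, by omega⟩

end Disagreement

end Counting

section Demand

variable {α β γ : Type*}

/-- A vertex together with the requirement that a vertex to be found is, or is not, adjacent to it.
-/
structure Demand (α : Type*) where
  point : α
  adj : Prop

namespace Demand

/-- `v` has the prescribed relation to the point of `s`. -/
def Meets (r : β → α → Prop) (v : β) (s : Demand α) : Prop :=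
  r v s.point ↔ s.adj

/-- Some vertex meets all three demands. -/
def Realizable (r : β → α → Prop) (s t u : Demand α) : Prop :=
  ∃ v, s.Meets r v ∧ t.Meets r v ∧ u.Meets r v

/-- Two demands made by an instance of the existential completeness of a graph with adjacency `r`:
the points to be joined form an independent set, and a point carries only one demand. -/
def Consistent (r : α → α → Prop) (s t : Demand α) : Prop :=
  (s.adj → t.adj → ¬ r s.point t.point) ∧ (s.point = t.point → (s.adj ↔ t.adj))

/-- The demand of the same kind on the image of the point. -/
@[simps] def map (f : α → γ) (s : Demand α) : Demand γ :=
  ⟨f s.point, s.adj⟩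

theorem Realizable.swap {r : β → α → Prop} {s t u : Demand α} :
    Realizable r s t u → Realizable r s u t
  | ⟨v, hs, ht, hu⟩ => ⟨v, hs, hu, ht⟩

theorem Realizable.rotate {r : β → α → Prop} {s t u : Demand α} :
    Realizable r s t u → Realizable r t u s
  | ⟨v, hs, ht, hu⟩ => ⟨v, ht, hu, hs⟩

theorem Consistent.symm {r : α → α → Prop} [Std.Symm r] {s t : Demand α} (h : s.Consistent r t) :
    t.Consistent r s :=
  ⟨fun ht hs hr => h.1 hs ht (_root_.symm hr), fun hst => (h.2 hst.symm).symm⟩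

variable {r : α → α → Prop} {r' : γ → γ → Prop} {s t u : Demand γ}

theorem Consistent.of_map (f : r' ↪r r) (h : (s.map f).Consistent r (t.map f)) :
    s.Consistent r' t :=
  ⟨fun hs ht hr => h.1 hs ht (f.map_rel_iff.2 hr), fun hst => h.2 (congrArg f hst)⟩

theorem Realizable.map (f : r' ↪r r) :
    Realizable r' s t u → Realizable r (s.map f) (t.map f) (u.map f)
  | ⟨v, hs, ht, hu⟩ =>
    ⟨f v, f.map_rel_iff.trans hs, f.map_rel_iff.trans ht, f.map_rel_iff.trans hu⟩

end Demand

theorem exists_subset_triple [DecidableEq α] [Nonempty α] {A : Finset α} (hA : A.card ≤ 3) :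
    ∃ a b c, A ⊆ {a, b, c} := by
  obtain ⟨x⟩ := ‹Nonempty α›
  obtain h | h | h | h : A.card = 0 ∨ A.card = 1 ∨ A.card = 2 ∨ A.card = 3 := by omega
  · exact ⟨x, x, x, by simp [Finset.card_eq_zero.1 h]⟩
  · obtain ⟨a, rfl⟩ := Finset.card_eq_one.1 h
    exact ⟨a, a, a, by simp⟩
  · obtain ⟨a, b, -, rfl⟩ := Finset.card_eq_two.1 h
    exact ⟨a, b, b, by simp⟩
  · obtain ⟨a, b, c, -, -, -, rfl⟩ := Finset.card_eq_three.1 h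
    exact ⟨a, b, c, subset_rfl⟩

theorem isExistentiallyComplete_three_of_realizable [Nonempty α] {G : SimpleGraph α}
    (h : ∀ s t u : Demand α, s.Consistent G.Adj t → s.Consistent G.Adj u → t.Consistent G.Adj u →
      Demand.Realizable G.Adj s t u) : G.IsExistentiallyComplete 3 := by
  classical
  intro A B hBA hA hB
  let demand (a : α) : Demand α := ⟨a, a ∈ B⟩
  have consistent (a b : α) : (demand a).Consistent G.Adj (demand b) :=
    ⟨fun ha hb hab => hB ha hb hab.ne hab, fun hab => by simp_all [demand]⟩
  obtain ⟨a, b, c, hsub⟩ := exists_subset_triple hA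
  obtain ⟨v, ha, hb, hc⟩ := h (demand a) (demand b) (demand c) (consistent a b) (consistent a c)
    (consistent b c)
  have hv : ∀ i ∈ A, (G.Adj v i ↔ i ∈ B) := by
    intro i hi
    obtain rfl | rfl | rfl : i = a ∨ i = b ∨ i = c := by simpa using hsub hi
    exacts [ha, hb, hc]
  exact ⟨v, fun i hi => (hv i (hBA hi)).2 hi, fun i hi hiB hvi => hiB ((hv i hi).1 hvi)⟩

end Demand

section Cube

open Demand

/-- The cube `ℤ₂^{3k-1}`. -/
abbrev Cube (k : ℕ) : Type := Fin (3 * k - 1) → ZMod 2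

variable {k : ℕ}

/-- Adjacency inside one copy of the cube. -/
def InnerAdj (x y : Cube k) : Prop :=
  hammingDist x y = 2 * k - 1 ∨ 2 * k + 1 ≤ hammingDist x y

/-- Adjacency between different copies of the cube. -/
def OuterAdj (x y : Cube k) : Prop :=
  2 * k ≤ hammingDist x y

/-- Two demands on the cube that can be met simultaneously from a further copy of it. -/
def Compatible (s t : Demand (Cube k)) : Prop :=
  (s.adj → t.adj → hammingDist s.point t.point + 2 ≤ 2 * k) ∧
    (s.point = t.point → (s.adj ↔ t.adj))

theorem Compatible.symm {s t : Demand (Cube k)} (h : Compatible s t) : Compatible t s :=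
  ⟨fun ht hs => hammingDist_comm t.point s.point ▸ h.1 hs ht, fun hst => (h.2 hst.symm).symm⟩

variable {x y z : Cube k}

theorem realizable_far_far_far (hxy : hammingDist x y + 2 ≤ 2 * k)
    (hxz : hammingDist x z + 2 ≤ 2 * k) (hyz : hammingDist y z + 2 ≤ 2 * k) :
    Realizable OuterAdj ⟨x, True⟩ ⟨y, True⟩ ⟨z, True⟩ := by
  obtain ⟨a, b, c, p, hn, hab, hac, hbc, H⟩ := exists_hammingDist_triple x y z
  rw [Fintype.card_fin] at hn
  simp only [Realizable, Meets, OuterAdj, iff_true]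
  obtain ⟨v, hx, hy, hz⟩ := H (a - (k - 1)) (by omega) (min b (k - 1)) (by omega)
    (min c (k - 1)) (by omega) p le_rfl
  exact ⟨v, by omega, by omega, by omega⟩

theorem realizable_far_far_near (hxy : hammingDist x y + 2 ≤ 2 * k) (hxz : x ≠ z) (hyz : y ≠ z) :
    Realizable OuterAdj ⟨x, True⟩ ⟨y, True⟩ ⟨z, False⟩ := by
  wlog hle : hammingDist x z ≤ hammingDist y z generalizing x y
  · rw [hammingDist_comm] at hxy
    exact (this hxy hyz hxz (by omega)).rotate.swap
  have hxz := hammingDist_pos.2 hxz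
  obtain ⟨a, b, c, p, hn, hab, hac, hbc, H⟩ := exists_hammingDist_triple x y z
  rw [Fintype.card_fin] at hn
  simp only [Realizable, Meets, OuterAdj, iff_true, iff_false]
  rcases le_total p (2 * k - max c 1) with hp | hp
  · obtain ⟨v, hx, hy, hz⟩ := H a le_rfl (2 * k - c - p - a) (by omega) c le_rfl p le_rfl
    exact ⟨v, by omega, by omega, by omega⟩
  · obtain ⟨v, hx, hy, hz⟩ := H a le_rfl 0 (by omega) c le_rfl (2 * k - max c 1) hp
    exact ⟨v, by omega, by omega, by omega⟩

theorem realizable_far_near_near (hxy : x ≠ y) (hxz : x ≠ z) :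
    Realizable OuterAdj ⟨x, True⟩ ⟨y, False⟩ ⟨z, False⟩ := by
  have hxy := hammingDist_pos.2 hxy
  have hxz := hammingDist_pos.2 hxz
  obtain ⟨a, b, c, p, hn, hab, hac, hbc, H⟩ := exists_hammingDist_triple x y z
  rw [Fintype.card_fin] at hn
  simp only [Realizable, Meets, OuterAdj, iff_true, iff_false]
  obtain ⟨B, hB, hB'⟩ : ∃ B ≤ b, B = min b (2 * k - 1) := ⟨_, by omega, rfl⟩
  obtain ⟨C, hC, hC'⟩ : ∃ C ≤ c, C = min c (2 * k - 1) := ⟨_, by omega, rfl⟩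
  obtain ⟨v, hx, hy, hz⟩ := H a le_rfl B hB C hC (2 * k - a - B - C) (by omega)
  exact ⟨v, by omega, by omega, by omega⟩

theorem realizable_near_near_near (hk : 1 ≤ k) (x y z : Cube k) :
    Realizable OuterAdj ⟨x, False⟩ ⟨y, False⟩ ⟨z, False⟩ := by
  obtain ⟨a, b, c, p, hn, hab, hac, hbc, H⟩ := exists_hammingDist_triple x y z
  rw [Fintype.card_fin] at hn
  simp only [Realizable, Meets, OuterAdj, iff_false]
  obtain ⟨v, hx, hy, hz⟩ := H (min a (2 * k - 1)) (by omega) (b - (2 * k - 1)) (by omega)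
    (c - (2 * k - 1)) (by omega) 0 (by omega)
  exact ⟨v, by omega, by omega, by omega⟩

theorem realizable_outerAdj_of_compatible (hk : 1 ≤ k) {s t u : Demand (Cube k)}
    (hst : Compatible s t) (hsu : Compatible s u) (htu : Compatible t u) :
    Realizable OuterAdj s t u := by
  obtain ⟨x, a⟩ := s
  obtain ⟨y, b⟩ := t
  obtain ⟨z, c⟩ := u
  by_cases ha : a <;> by_cases hb : b <;> by_cases hc : c <;>
    simp only [Compatible, ha, hb, hc, forall_const, iff_true, iff_false, imp_false,
      false_imp_iff, not_true_eq_false, implies_true, and_true, true_and] at hst hsu htu ⊢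
  · exact realizable_far_far_far hst hsu htu
  · exact realizable_far_far_near hst hsu htu
  · exact (realizable_far_far_near hsu hst (Ne.symm htu)).swap
  · exact realizable_far_near_near hst hsu
  · exact (realizable_far_far_near htu (Ne.symm hst) (Ne.symm hsu)).rotate.rotate
  · exact (realizable_far_near_near htu (Ne.symm hst)).rotate.rotate
  · exact (realizable_far_near_near (Ne.symm hsu) (Ne.symm htu)).rotate
  · exact realizable_near_near_near hk x y z

theorem exists_meets_of_hammingDist_eq (hxy : hammingDist x y = 2 * k - 1)
    {u : Demand (Cube k)} (hxu : u.adj → ¬ OuterAdj x u.point) (hyu : Compatible ⟨y, True⟩ u) :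
    ∃ v, hammingDist v x = 2 * k - 1 ∧ hammingDist v y = 2 * k ∧ u.Meets OuterAdj v := by
  obtain ⟨z, b⟩ := u
  simp only [Compatible, Meets, OuterAdj, forall_const, true_iff] at hxu hyu ⊢
  obtain ⟨a, d, c, p, hn, had, hac, hdc, H⟩ := exists_hammingDist_triple x y z
  rw [Fintype.card_fin] at hn
  by_cases hb : b
  · have := hxu hb
    have := hyu.1 hb
    obtain ⟨v, hx, hy, hz⟩ := H (k - 1 - min d (k - 1)) (by omega) (min d (k - 1)) (by omega)
      c le_rfl p le_rfl
    exact ⟨v, by omega, by omega, by simp only [hb, iff_true]; omega⟩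
  · have := hammingDist_pos.2 (mt hyu.2 hb)
    obtain ⟨v, hx, hy, hz⟩ := H (min a (k - 1)) (by omega) (k - 1 - min a (k - 1)) (by omega)
      c le_rfl p le_rfl
    exact ⟨v, by omega, by omega, by simp only [hb, iff_false]; omega⟩

theorem exists_meets_hammingDist_eq_two_mul_sub_one (x : Cube k) {u : Demand (Cube k)} (hk : 1 ≤ k)
    (hxu : u.adj → x ≠ u.point ∧ ¬ OuterAdj x u.point) :
    ∃ v, hammingDist v x = 2 * k - 1 ∧ u.Meets OuterAdj v := by
  obtain ⟨z, b⟩ := u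
  simp only [Meets, OuterAdj] at hxu ⊢
  obtain ⟨a, d, c, p, hn, had, hac, hdc, H⟩ := exists_hammingDist_triple x x z
  rw [Fintype.card_fin] at hn
  rw [hammingDist_self] at had
  by_cases hb : b
  · have := (hxu hb).2
    have := hammingDist_pos.2 (hxu hb).1
    obtain ⟨v, hx, -, hz⟩ := H 0 (by omega) 0 (by omega) (2 * k - 1 - min p (2 * k - 1)) (by omega)
      (min p (2 * k - 1)) (by omega)
    exact ⟨v, by omega, by simp only [hb, iff_true]; omega⟩
  · obtain ⟨v, hx, -, hz⟩ := H 0 (by omega) 0 (by omega) (min c (2 * k - 1)) (by omega)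
      (2 * k - 1 - min c (2 * k - 1)) (by omega)
    exact ⟨v, by omega, by simp only [hb, iff_false]; omega⟩

theorem exists_meets_hammingDist_eq_two_mul {u : Demand (Cube k)}
    (hxu : Compatible ⟨x, True⟩ u) : ∃ v, hammingDist v x = 2 * k ∧ u.Meets OuterAdj v := by
  obtain ⟨z, b⟩ := u
  simp only [Compatible, Meets, OuterAdj, forall_const, true_iff] at hxu ⊢
  obtain ⟨a, d, c, p, hn, had, hac, hdc, H⟩ := exists_hammingDist_triple x x z
  rw [Fintype.card_fin] at hn
  rw [hammingDist_self] at had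
  by_cases hb : b
  · have := hxu.1 hb
    obtain ⟨v, hx, -, hz⟩ := H 0 (by omega) 0 (by omega) (2 * k - min p (2 * k)) (by omega)
      (min p (2 * k)) (by omega)
    exact ⟨v, by omega, by simp only [hb, iff_true]; omega⟩
  · have := hammingDist_pos.2 (mt hxu.2 hb)
    obtain ⟨v, hx, -, hz⟩ := H 0 (by omega) 0 (by omega) (min c (2 * k)) (by omega)
      (2 * k - min c (2 * k)) (by omega)
    exact ⟨v, by omega, by simp only [hb, iff_false]; omega⟩

theorem exists_meets_inner_of_not_compatible (hk : 1 ≤ k) {s t u : Demand (Cube k)}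
    (hst : s.adj → t.adj → ¬ OuterAdj s.point t.point)
    (hsu : s.adj → u.adj → ¬ OuterAdj s.point u.point) (htu : Compatible t u)
    (h : ¬ Compatible s t) :
    ∃ v, s.Meets InnerAdj v ∧ t.Meets OuterAdj v ∧ u.Meets OuterAdj v := by
  obtain ⟨x, a⟩ := s
  obtain ⟨y, b⟩ := t
  by_cases ha : a
  · simp only [ha, forall_const] at hst hsu
    by_cases hb : b
    · simp only [Compatible, ha, hb, forall_const, implies_true, and_true] at h
      simp only [hb, OuterAdj, forall_const] at hst
      obtain ⟨v, hx, hy, hz⟩ := exists_meets_of_hammingDist_eq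
        (show hammingDist x y = 2 * k - 1 by omega) hsu (by simpa [hb] using htu)
      exact ⟨v, by simp [Meets, InnerAdj, ha, hx], by simp [Meets, OuterAdj, hb, hy], hz⟩
    · obtain rfl : x = y := by simpa [Compatible, ha, hb] using h
      obtain ⟨v, hx, hz⟩ := exists_meets_hammingDist_eq_two_mul_sub_one x hk
        fun hu => ⟨fun hxu => hb ((htu.2 hxu).2 hu), hsu hu⟩
      exact ⟨v, by simp [Meets, InnerAdj, ha, hx], by simp [Meets, OuterAdj, hb, hx]; omega, hz⟩
  · obtain ⟨rfl, hb⟩ : x = y ∧ b := by simpa [Compatible, ha] using h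
    obtain ⟨v, hx, hz⟩ := exists_meets_hammingDist_eq_two_mul (by simpa [hb] using htu)
    exact ⟨v, by simp [Meets, InnerAdj, ha, hx]; omega, by simp [Meets, OuterAdj, hb, hx], hz⟩

/-- `s` is met from its own copy of the cube or from a further one. -/
theorem exists_meets_inner_or_outer (hk : 1 ≤ k) {s t u : Demand (Cube k)}
    (hst : s.adj → t.adj → ¬ OuterAdj s.point t.point)
    (hsu : s.adj → u.adj → ¬ OuterAdj s.point u.point) (htu : Compatible t u) :
    ∃ v, (s.Meets InnerAdj v ∨ s.Meets OuterAdj v) ∧ t.Meets OuterAdj v ∧ u.Meets OuterAdj v := by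
  by_cases hst' : Compatible s t
  · by_cases hsu' : Compatible s u
    · obtain ⟨v, hs, htu⟩ := realizable_outerAdj_of_compatible hk hst' hsu' htu
      exact ⟨v, Or.inr hs, htu⟩
    · obtain ⟨v, hs, hu, ht⟩ := exists_meets_inner_of_not_compatible hk hsu hst htu.symm hsu'
      exact ⟨v, Or.inl hs, ht, hu⟩
  · obtain ⟨v, hs, htu⟩ := exists_meets_inner_of_not_compatible hk hst hsu htu hst'
    exact ⟨v, Or.inl hs, htu⟩

theorem exists_meets_outer_of_hammingDist_eq_two_mul (hk : 1 ≤ k) (hxy : hammingDist x y = 2 * k)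
    {u : Demand (Cube k)} (hxu : u.adj → ¬ OuterAdj x u.point)
    (hyu : u.adj → ¬ OuterAdj y u.point) :
    ∃ v, hammingDist v x = 2 * k - 1 ∧ hammingDist v y = 2 * k - 1 ∧ u.Meets OuterAdj v := by
  obtain ⟨z, e⟩ := u
  simp only [Meets, OuterAdj] at hxu hyu ⊢
  obtain ⟨a, b, c, p, hn, hab, hac, hbc, H⟩ := exists_hammingDist_triple x y z
  rw [Fintype.card_fin] at hn
  by_cases he : e
  · have := hxu he
    have := hyu he
    simp only [he, iff_true]
    rcases le_total b k with hbk | hbk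
    · obtain ⟨v, hx, hy, hz⟩ := H (k - b) (by omega) b le_rfl c le_rfl p le_rfl
      exact ⟨v, by omega, by omega, by omega⟩
    · obtain ⟨v, hx, hy, hz⟩ := H 0 (by omega) k hbk c le_rfl p le_rfl
      exact ⟨v, by omega, by omega, by omega⟩
  · simp only [he, iff_false]
    rcases le_total a k with hak | hak
    · obtain ⟨v, hx, hy, hz⟩ := H a le_rfl (k - a) (by omega) c le_rfl p le_rfl
      exact ⟨v, by omega, by omega, by omega⟩
    · obtain ⟨v, hx, hy, hz⟩ := H k hak 0 (by omega) c le_rfl p le_rfl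
      exact ⟨v, by omega, by omega, by omega⟩

theorem exists_meets_inner_of_hammingDist_eq_two_mul (hk : 1 ≤ k) (hxy : hammingDist x y = 2 * k)
    {u : Demand (Cube k)} (hxu : Consistent InnerAdj ⟨x, True⟩ u)
    (hyu : Consistent InnerAdj ⟨y, True⟩ u) :
    ∃ v, hammingDist v x = 2 * k - 1 ∧ hammingDist v y = 2 * k - 1 ∧ u.Meets InnerAdj v := by
  obtain ⟨z, e⟩ := u
  simp only [Consistent, Meets, InnerAdj, forall_const, true_iff] at hxu hyu ⊢
  obtain ⟨a, b, c, p, hn, hab, hac, hbc, H⟩ := exists_hammingDist_triple x y z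
  rw [Fintype.card_fin] at hn
  by_cases he : e
  · have := hxu.1 he
    have := hyu.1 he
    simp only [he, iff_true]
    rcases le_total b k with hbk | hbk
    · obtain ⟨v, hx, hy, hz⟩ := H (k - b) (by omega) b le_rfl c le_rfl p le_rfl
      exact ⟨v, by omega, by omega, by omega⟩
    · obtain ⟨v, hx, hy, hz⟩ := H 0 (by omega) k hbk c le_rfl p le_rfl
      exact ⟨v, by omega, by omega, by omega⟩
  · have := hammingDist_pos.2 (mt hxu.2 he)
    have := hammingDist_pos.2 (mt hyu.2 he)
    simp only [he, iff_false]
    rcases le_total a k with hak | hak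
    · obtain ⟨v, hx, hy, hz⟩ := H a le_rfl (k - a) (by omega) c le_rfl p le_rfl
      exact ⟨v, by omega, by omega, by omega⟩
    · obtain ⟨v, hx, hy, hz⟩ := H k hak 0 (by omega) c le_rfl p le_rfl
      exact ⟨v, by omega, by omega, by omega⟩

theorem exists_perimeter_eq (x y z : Cube k) :
    ∃ e, hammingDist x y + hammingDist x z + hammingDist y z = 2 * e ∧ e ≤ 3 * k - 1 := by
  obtain ⟨a, b, c, p, hn, hab, hac, hbc, -⟩ := exists_hammingDist_triple x y z
  rw [Fintype.card_fin] at hn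
  exact ⟨a + b + c, by omega, by omega⟩

end Cube

section LayeredCube

open Demand

/-- Adjacency in the graph formed by copies of the cube indexed by `C`. -/
def LayeredAdj {C : Type*} {k : ℕ} (p q : C × Cube k) : Prop :=
  (p.1 = q.1 ∧ InnerAdj p.2 q.2) ∨ (p.1 ≠ q.1 ∧ OuterAdj p.2 q.2)

namespace LayeredAdj

variable {C : Type*} {k : ℕ}

instance : Std.Symm (LayeredAdj : C × Cube k → C × Cube k → Prop) where
  symm p q h := by
    simpa only [LayeredAdj, InnerAdj, OuterAdj, eq_comm, ne_comm, hammingDist_comm] using h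

theorem iff_inner {p q : C × Cube k} (h : p.1 = q.1) : LayeredAdj p q ↔ InnerAdj p.2 q.2 := by
  simp only [LayeredAdj, h, true_and, ne_eq, not_true_eq_false, false_and, or_false]

theorem iff_outer {p q : C × Cube k} (h : p.1 ≠ q.1) : LayeredAdj p q ↔ OuterAdj p.2 q.2 := by
  simp only [LayeredAdj, h, false_and, ne_eq, not_false_eq_true, true_and, false_or]

theorem not_triangle (hk : 1 ≤ k) {p q r : C × Cube k} (hpq : LayeredAdj p q)
    (hpr : LayeredAdj p r) (hqr : LayeredAdj q r) : False := by
  obtain ⟨e, he, hek⟩ := exists_perimeter_eq p.2 q.2 r.2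
  rcases hpq with ⟨hpq, dpq⟩ | ⟨hpq, dpq⟩ <;> rcases hpr with ⟨hpr, dpr⟩ | ⟨hpr, dpr⟩ <;>
    rcases hqr with ⟨hqr, dqr⟩ | ⟨hqr, dqr⟩ <;> simp only [InnerAdj, OuterAdj] at dpq dpr dqr <;>
    first | omega | simp_all only [ne_eq, not_true_eq_false]

theorem compatible_or_hammingDist_eq {s t : Demand (C × Cube k)} (hC : s.point.1 = t.point.1)
    (hst : s.Consistent LayeredAdj t) : Compatible (s.map Prod.snd) (t.map Prod.snd) ∨
      s.adj ∧ t.adj ∧ hammingDist s.point.2 t.point.2 = 2 * k := by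
  obtain ⟨hadj, heq⟩ := hst
  rw [iff_inner hC] at hadj
  simp only [Compatible, map_point, map_adj, InnerAdj] at hadj ⊢
  by_cases hs : s.adj <;> by_cases ht : t.adj <;>
    simp only [hs, ht, forall_const, false_imp_iff, true_and, false_and, Prod.ext_iff, hC,
      iff_self, implies_true, and_self, and_true, or_false] at hadj heq ⊢ <;> try exact heq
  omega

theorem realizable_of_hammingDist_eq_two_mul (hk : 1 ≤ k) {s t u : Demand (C × Cube k)}
    (hC : s.point.1 = t.point.1) (hs : s.adj) (ht : t.adj)
    (hst : hammingDist s.point.2 t.point.2 = 2 * k) (hsu : s.Consistent LayeredAdj u)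
    (htu : t.Consistent LayeredAdj u) : Realizable LayeredAdj s t u := by
  obtain ⟨⟨c, x⟩, a⟩ := s
  obtain ⟨⟨c', y⟩, b⟩ := t
  obtain ⟨⟨f, z⟩, e⟩ := u
  obtain rfl : c = c' := hC
  obtain rfl : a = True := eq_true hs
  obtain rfl : b = True := eq_true ht
  by_cases hf : c = f
  · subst hf
    obtain ⟨v, hvx, hvy, hvz⟩ := exists_meets_inner_of_hammingDist_eq_two_mul hk hst
      (u := ⟨z, e⟩) (by simpa [Consistent, LayeredAdj] using hsu)
      (by simpa [Consistent, LayeredAdj] using htu)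
    exact ⟨(c, v), by simp [Meets, LayeredAdj, InnerAdj, hvx],
      by simp [Meets, LayeredAdj, InnerAdj, hvy], by simpa [Meets, LayeredAdj] using hvz⟩
  · obtain ⟨v, hvx, hvy, hvz⟩ := exists_meets_outer_of_hammingDist_eq_two_mul hk hst
      (u := ⟨z, e⟩) (by simpa [Consistent, LayeredAdj, hf] using hsu)
      (by simpa [Consistent, LayeredAdj, hf] using htu)
    exact ⟨(c, v), by simp [Meets, LayeredAdj, InnerAdj, hvx],
      by simp [Meets, LayeredAdj, InnerAdj, hvy], by simpa [Meets, LayeredAdj, hf] using hvz⟩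

theorem realizable_of_compatible (hk : 1 ≤ k) {s t u : Demand (C × Cube k)} {f : C}
    (hs : f ≠ s.point.1) (ht : f ≠ t.point.1) (hu : f ≠ u.point.1)
    (hst : Compatible (s.map Prod.snd) (t.map Prod.snd))
    (hsu : Compatible (s.map Prod.snd) (u.map Prod.snd))
    (htu : Compatible (t.map Prod.snd) (u.map Prod.snd)) : Realizable LayeredAdj s t u := by
  obtain ⟨v, hvs, hvt, hvu⟩ := realizable_outerAdj_of_compatible hk hst hsu htu
  exact ⟨(f, v), (iff_outer hs).trans hvs, (iff_outer ht).trans hvt, (iff_outer hu).trans hvu⟩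

theorem realizable_of_compatible_of_ne (hk : 1 ≤ k) {s t u : Demand (C × Cube k)} {f : C}
    (hs : f ≠ s.point.1) (ht : f ≠ t.point.1) (hu : f ≠ u.point.1)
    (hCt : s.point.1 ≠ t.point.1) (hCu : s.point.1 ≠ u.point.1)
    (hst : s.Consistent LayeredAdj t) (hsu : s.Consistent LayeredAdj u)
    (htu : Compatible (t.map Prod.snd) (u.map Prod.snd)) : Realizable LayeredAdj s t u := by
  obtain ⟨v, hvs | hvs, hvt, hvu⟩ := exists_meets_inner_or_outer (s := s.map Prod.snd)
    (t := t.map Prod.snd) (u := u.map Prod.snd) hk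
    (fun h₁ h₂ => (iff_outer hCt).not.1 (hst.1 h₁ h₂))
    (fun h₁ h₂ => (iff_outer hCu).not.1 (hsu.1 h₁ h₂)) htu
  · exact ⟨(s.point.1, v), (iff_inner (p := (s.point.1, v)) (q := s.point) rfl).trans hvs,
      (iff_outer (p := (s.point.1, v)) hCt).trans hvt,
      (iff_outer (p := (s.point.1, v)) hCu).trans hvu⟩
  · exact ⟨(f, v), (iff_outer hs).trans hvs, (iff_outer ht).trans hvt, (iff_outer hu).trans hvu⟩

theorem exists_compatible_of_pairwise_ne {s t u : Demand (C × Cube k)}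
    (hCst : s.point.1 ≠ t.point.1) (hCsu : s.point.1 ≠ u.point.1) (hCtu : t.point.1 ≠ u.point.1)
    (hst : s.Consistent LayeredAdj t) (hsu : s.Consistent LayeredAdj u)
    (htu : t.Consistent LayeredAdj u) :
    Compatible (s.map Prod.snd) (t.map Prod.snd) ∨ Compatible (s.map Prod.snd) (u.map Prod.snd) ∨
      Compatible (t.map Prod.snd) (u.map Prod.snd) := by
  obtain ⟨e, he, -⟩ := exists_perimeter_eq s.point.2 t.point.2 u.point.2
  have hst := hst.1
  have hsu := hsu.1
  have htu := htu.1
  simp only [iff_outer hCst, iff_outer hCsu, iff_outer hCtu, OuterAdj] at hst hsu htu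
  simp only [Compatible, map_point, map_adj, ← hammingDist_eq_zero]
  by_cases hs : s.adj <;> by_cases ht : t.adj <;> by_cases hu : u.adj <;>
    simp only [hs, ht, hu, forall_const, false_imp_iff, true_and, iff_self, implies_true, and_true,
      iff_true, iff_false, not_true_eq_false, imp_false, or_true, true_or]
      at hst hsu htu ⊢ <;> omega

theorem realizable_of_incompatible (hk : 1 ≤ k) {s t u : Demand (C × Cube k)}
    (hC : s.point.1 = t.point.1) (hst : s.Consistent LayeredAdj t)
    (hsu : s.Consistent LayeredAdj u) (htu : t.Consistent LayeredAdj u)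
    (h : ¬ Compatible (s.map Prod.snd) (t.map Prod.snd)) : Realizable LayeredAdj s t u := by
  obtain ⟨hs, ht, hd⟩ := (compatible_or_hammingDist_eq hC hst).resolve_left h
  exact realizable_of_hammingDist_eq_two_mul hk hC hs ht hd hsu htu

theorem realizable_of_eq_of_ne (hk : 1 ≤ k) {s t u : Demand (C × Cube k)} {f : C}
    (hs : f ≠ s.point.1) (hu : f ≠ u.point.1)
    (hCst : s.point.1 = t.point.1) (hCu : s.point.1 ≠ u.point.1) (hst : s.Consistent LayeredAdj t)
    (hsu : s.Consistent LayeredAdj u) (htu : t.Consistent LayeredAdj u) :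
    Realizable LayeredAdj s t u := by
  by_cases h : Compatible (s.map Prod.snd) (t.map Prod.snd)
  · exact (realizable_of_compatible_of_ne hk hu hs (hCst ▸ hs) hCu.symm (hCst ▸ hCu.symm)
      hsu.symm htu.symm h).rotate
  · exact realizable_of_incompatible hk hCst hst hsu htu h

theorem realizable_of_eq (hk : 1 ≤ k) {s t u : Demand (C × Cube k)} {f : C}
    (hs : f ≠ s.point.1) (hCst : s.point.1 = t.point.1) (hCsu : s.point.1 = u.point.1)
    (hst : s.Consistent LayeredAdj t) (hsu : s.Consistent LayeredAdj u)
    (htu : t.Consistent LayeredAdj u) : Realizable LayeredAdj s t u := by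
  by_cases h₁ : Compatible (s.map Prod.snd) (t.map Prod.snd)
  · by_cases h₂ : Compatible (s.map Prod.snd) (u.map Prod.snd)
    · by_cases h₃ : Compatible (t.map Prod.snd) (u.map Prod.snd)
      · exact realizable_of_compatible hk hs (hCst ▸ hs) (hCsu ▸ hs) h₁ h₂ h₃
      · exact (realizable_of_incompatible hk (hCst.symm.trans hCsu) htu hst.symm hsu.symm
          h₃).rotate.rotate
    · exact (realizable_of_incompatible hk hCsu hsu hst htu.symm h₂).swap
  · exact realizable_of_incompatible hk hCst hst hsu htu h₁

theorem realizable_of_pairwise_ne (hk : 1 ≤ k) {s t u : Demand (C × Cube k)} {f : C}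
    (hs : f ≠ s.point.1) (ht : f ≠ t.point.1) (hu : f ≠ u.point.1)
    (hCst : s.point.1 ≠ t.point.1) (hCsu : s.point.1 ≠ u.point.1) (hCtu : t.point.1 ≠ u.point.1)
    (hst : s.Consistent LayeredAdj t) (hsu : s.Consistent LayeredAdj u)
    (htu : t.Consistent LayeredAdj u) : Realizable LayeredAdj s t u := by
  obtain h | h | h := exists_compatible_of_pairwise_ne hCst hCsu hCtu hst hsu htu
  · exact (realizable_of_compatible_of_ne hk hu hs ht hCsu.symm hCtu.symm hsu.symm htu.symm
      h).rotate
  · exact (realizable_of_compatible_of_ne hk ht hs hu hCst.symm hCtu hst.symm htu h).rotate.swap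
  · exact realizable_of_compatible_of_ne hk hs ht hu hCst hCsu hst hsu h

theorem realizable [Fintype C] (hk : 1 ≤ k) (hC : 4 ≤ Fintype.card C) {s t u : Demand (C × Cube k)}
    (hst : s.Consistent LayeredAdj t) (hsu : s.Consistent LayeredAdj u)
    (htu : t.Consistent LayeredAdj u) : Realizable LayeredAdj s t u := by
  classical
  obtain ⟨f, hs, ht, hu⟩ : ∃ f : C, f ≠ s.point.1 ∧ f ≠ t.point.1 ∧ f ≠ u.point.1 := by
    obtain ⟨f, -, hf⟩ := Finset.exists_mem_notMem_of_card_lt_card (t := Finset.univ)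
      ((Finset.card_le_three (a := s.point.1) (b := t.point.1) (c := u.point.1)).trans_lt hC)
    exact ⟨f, by simpa using hf⟩
  obtain hCst | hCst := eq_or_ne s.point.1 t.point.1 <;>
    obtain hCsu | hCsu := eq_or_ne s.point.1 u.point.1
  · exact realizable_of_eq hk hs hCst hCsu hst hsu htu
  · exact realizable_of_eq_of_ne hk hs hu hCst hCsu hst hsu htu
  · exact (realizable_of_eq_of_ne hk hs ht hCsu hCst hsu hst htu.symm).swap
  · obtain hCtu | hCtu := eq_or_ne t.point.1 u.point.1
    · exact (realizable_of_eq_of_ne hk ht hs hCtu hCst.symm htu hst.symm hsu.symm).rotate.rotate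
    · exact realizable_of_pairwise_ne hk hs ht hu hCst hCsu hCtu hst hsu htu

end LayeredAdj

end LayeredCube

section Twist

open Finset

/-- The distance from `0` to `a` on the cycle `ℤ/4ℤ`. -/
def arc (a : ZMod 4) : ℕ :=
  a.valMinAbs.natAbs

/-- The position of `(a, b)` on the cycle `(0, 0), (0, 1), (1, 1), (1, 0)`, which is the square
`ℤ₂²` with its Hamming metric. -/
def grayAngle (a b : ZMod 2) : ZMod 4 :=
  if a = 0 then if b = 0 then 0 else 1 else if b = 0 then 3 else 2

variable {n : ℕ}

/-- All coordinates but the first two, which the twist leaves alone. -/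
def tail (x : Fin n → ZMod 2) (i : Fin (n - 2)) : ZMod 2 :=
  x ⟨i + 2, by omega⟩

variable (hn : 2 ≤ n)

/-- The position of the first two coordinates on a cycle of length four, on which the twist acts as
a quarter turn. -/
def angle (x : Fin n → ZMod 2) : ZMod 4 :=
  grayAngle (x ⟨0, by omega⟩) (x ⟨1, by omega⟩)

theorem hammingDist_eq_arc_add_hammingDist_tail (x y : Fin n → ZMod 2) :
    hammingDist x y = arc (angle hn x - angle hn y) + hammingDist (tail x) (tail y) := by
  have head : ∀ a b c d : ZMod 2, (if a ≠ c then 1 else 0) + (if b ≠ d then 1 else 0) =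
      arc (grayAngle a b - grayAngle c d) := by decide
  obtain ⟨N, rfl⟩ := Nat.exists_eq_add_of_le' hn
  rw [hammingDist, card_filter, Fin.sum_univ_succ, Fin.sum_univ_succ, ← add_assoc]
  exact congrArg₂ _ (head ..) (card_filter ..).symm

theorem angle_twist (x : Fin n → ZMod 2) : angle hn (twist hn x) = angle hn x + 1 := by
  have quarter : ∀ a b : ZMod 2, grayAngle b (a + 1) = grayAngle a b + 1 := by decide
  exact quarter ..

theorem tail_twist (x : Fin n → ZMod 2) : tail (twist hn x) = tail x := by
  ext i
  simp [tail, twist]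

theorem hammingDist_twist (x y : Fin n → ZMod 2) :
    hammingDist (twist hn x) (twist hn y) = hammingDist x y := by
  simp only [hammingDist_eq_arc_add_hammingDist_tail hn, angle_twist, tail_twist,
    add_sub_add_right_eq_sub]

theorem twist_injective : Function.Injective (twist hn) := fun x y h => by
  rw [← hammingDist_eq_zero, ← hammingDist_twist hn, h, hammingDist_self]

/-- The twist as a permutation of the cube. -/
noncomputable def twistPerm : Equiv.Perm (Fin n → ZMod 2) :=
  .ofBijective (twist hn) (Finite.injective_iff_bijective.1 (twist_injective hn))

theorem zpow_apply_eq_add_zsmul {α A : Type*} [AddGroup A] {σ : Equiv.Perm α} {f : α → A} {a : A}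
    (h : ∀ x, f (σ x) = f x + a) (s : ℤ) (x : α) : f ((σ ^ s) x) = f x + s • a := by
  induction s generalizing x with
  | zero => simp
  | succ s ih => rw [zpow_add_one, Equiv.Perm.mul_apply, ih, h, add_one_zsmul, add_assoc,
      ← one_add_zsmul, ← add_one_zsmul, add_comm 1]
  | pred s ih =>
    have hx := h ((σ ^ (-s - 1 : ℤ)) x)
    rw [← Equiv.Perm.mul_apply, ← zpow_one_add, add_sub_cancel, ih] at hx
    rw [sub_one_zsmul, ← add_assoc, hx, add_neg_cancel_right]

theorem angle_twistPerm_zpow (s : ℤ) (x : Fin n → ZMod 2) :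
    angle hn ((twistPerm hn ^ s) x) = angle hn x + s := by
  rw [zpow_apply_eq_add_zsmul (f := angle hn) (angle_twist hn), zsmul_one]

theorem tail_twistPerm_zpow (s : ℤ) (x : Fin n → ZMod 2) :
    tail ((twistPerm hn ^ s) x) = tail x := by
  rw [zpow_apply_eq_add_zsmul (f := tail) (a := 0)
    fun x => (tail_twist hn x).trans (add_zero _).symm, zsmul_zero, add_zero]

theorem hammingDist_twistPerm_zpow (s t : ℤ) (x y : Fin n → ZMod 2) :
    hammingDist ((twistPerm hn ^ s) x) ((twistPerm hn ^ t) y) =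
      arc (angle hn x - angle hn y + (s - t : ℤ)) + hammingDist (tail x) (tail y) := by
  rw [hammingDist_eq_arc_add_hammingDist_tail hn]
  simp only [angle_twistPerm_zpow, tail_twistPerm_zpow, Int.cast_sub]
  congr 2
  ring

end Twist

section TwistedGraph

open Demand

theorem innerAdj_iff_mem {k : ℕ} (x y : Cube k) : InnerAdj x y ↔
    hammingDist x y ∈ insert (2 * k - 1) (Finset.Icc (2 * k + 1) (3 * k - 1)) := by
  have hle := hammingDist_le_card_fintype (x := x) (y := y)
  rw [Fintype.card_fin] at hle
  simp only [InnerAdj, Finset.mem_insert, Finset.mem_Icc, hle, and_true]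

theorem outerAdj_iff_mem {k : ℕ} (x y : Cube k) : OuterAdj x y ↔
    hammingDist x y ∈ Finset.Icc (2 * k) (3 * k - 1) := by
  have hle := hammingDist_le_card_fintype (x := x) (y := y)
  rw [Fintype.card_fin] at hle
  simp only [OuterAdj, Finset.mem_Icc, hle, and_true]

theorem two_le_three_mul_sub_one {k : ℕ} (hk : 1 ≤ k) : 2 ≤ 3 * k - 1 := by
  omega

namespace Tournament

variable {V : Type*} (T : Tournament V)

theorem adj_or_adj_of_ne {i j : V} (h : i ≠ j) : T.Adj i j ∨ T.Adj j i := by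
  rw [T.exactlyOne i j h]
  exact em' _

open Classical in
/-- The sign of the arc between `c` and `i`, which is the number of quarter turns by which the part
of the twisted graph over `i` appears rotated from the part over `c`. -/
noncomputable def turn (c i : V) : ℤ :=
  if c = i then 0 else if T.Adj c i then 1 else -1

theorem turn_self (i : V) : T.turn i i = 0 :=
  if_pos rfl

variable {T}

theorem turn_of_adj {c i : V} (h : T.Adj c i) : T.turn c i = 1 := by
  rw [turn, if_neg fun hci => T.irrefl _ (hci ▸ h), if_pos h]

theorem turn_of_adj_symm {c i : V} (h : T.Adj i c) : T.turn c i = -1 := by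
  have hne : i ≠ c := fun hic => T.irrefl _ (hic ▸ h)
  rw [turn, if_neg hne.symm, if_neg ((T.exactlyOne i c hne).1 h)]

variable (T) in
theorem turn_symm (i j : V) : T.turn j i = -T.turn i j := by
  obtain rfl | hij := eq_or_ne i j
  · rw [turn_self, neg_zero]
  · obtain h | h := T.adj_or_adj_of_ne hij <;> simp [turn_of_adj h, turn_of_adj_symm h]

variable (T) in
theorem turn_cast_eq {R : Type*} [Ring R] {c i : V} (h : c ≠ i) :
    (T.turn c i : R) = 1 ∨ (T.turn c i : R) = -1 := by
  obtain h | h := T.adj_or_adj_of_ne h <;> simp [turn_of_adj h, turn_of_adj_symm h]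

end Tournament

variable {V : Type*} {T : Tournament V} {m k : ℕ} {hk : 1 ≤ k} {c : V} {p q r : V × Fin m × Cube k}

variable (T hk c) in
/-- The position of a vertex of the twisted graph in the cube as seen from the part over `c`. -/
noncomputable def view (p : V × Fin m × Cube k) : Cube k :=
  (twistPerm (two_le_three_mul_sub_one hk) ^ T.turn c p.1) p.2.2

theorem view_of_eq (h : c = p.1) : view T hk c p = p.2.2 := by
  rw [view, h, T.turn_self, zpow_zero, Equiv.Perm.one_apply]

theorem hammingDist_view (c : V) (p q : V × Fin m × Cube k) :
    hammingDist (view T hk c p) (view T hk c q) =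
      arc (angle (two_le_three_mul_sub_one hk) p.2.2 - angle (two_le_three_mul_sub_one hk) q.2.2 +
        (T.turn c p.1 - T.turn c q.1 : ℤ)) + hammingDist (tail p.2.2) (tail q.2.2) :=
  hammingDist_twistPerm_zpow ..

theorem hammingDist_view_of_eq (h : c = p.1 ∨ c = q.1 ∨ p.1 = q.1) :
    hammingDist (view T hk c p) (view T hk c q) =
      hammingDist (view T hk p.1 p) (view T hk p.1 q) := by
  have hturn : T.turn c p.1 - T.turn c q.1 = T.turn p.1 p.1 - T.turn p.1 q.1 := by
    obtain rfl | rfl | h := h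
    · rfl
    · rw [T.turn_self, T.turn_self, T.turn_symm, sub_zero, zero_sub]
    · rw [h, sub_self, sub_self]
  rw [hammingDist_view, hammingDist_view, hturn]

theorem twistedGraph_adj_iff_view_left : (twistedGraph T m k hk).Adj p q ↔
    LayeredAdj ((p.1, p.2.1), p.2.2) ((q.1, q.2.1), view T hk p.1 q) := by
  simp only [twistedGraph, hypercubeGraph, LayeredAdj, ← innerAdj_iff_mem, ← outerAdj_iff_mem]
  obtain h | h := eq_or_ne p.1 q.1
  · simp [h, view_of_eq, T.irrefl]
  · obtain ha | ha := T.adj_or_adj_of_ne h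
    · have hna := (T.exactlyOne _ _ h).1 ha
      simp [h, ha, hna, view, Tournament.turn_of_adj ha, twistPerm]
    · have hna := (T.exactlyOne _ _ h.symm).1 ha
      have hd := hammingDist_view_of_eq (T := T) (hk := hk) (p := p) (c := q.1)
        (.inr (.inl rfl))
      rw [view_of_eq rfl, view_of_eq rfl, hammingDist_comm] at hd
      simp only [h, ne_eq, OuterAdj, false_and, hna, ha, true_and, false_or, Prod.mk.injEq,
        not_false_eq_true, ← hd]
      simp [view, Tournament.turn_of_adj ha, twistPerm]

theorem LayeredAdj.congr_hammingDist {C : Type*} {a b : C} {x y x' y' : Cube k}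
    (h : hammingDist x y = hammingDist x' y') :
    LayeredAdj (a, x) (b, y) ↔ LayeredAdj (a, x') (b, y') := by
  simp only [LayeredAdj, InnerAdj, OuterAdj, h]

theorem twistedGraph_adj_iff_view (h : c = p.1 ∨ c = q.1 ∨ p.1 = q.1) :
    (twistedGraph T m k hk).Adj p q ↔
      LayeredAdj ((p.1, p.2.1), view T hk c p) ((q.1, q.2.1), view T hk c q) := by
  rw [twistedGraph_adj_iff_view_left]
  refine LayeredAdj.congr_hammingDist ?_
  rw [hammingDist_view_of_eq h, view_of_eq rfl]

variable (T hk) in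
/-- The distance of two vertices of the twisted graph as seen from the part over `c`. -/
noncomputable def viewDist (c : V) (p q : V × Fin m × Cube k) : ℕ :=
  hammingDist (view T hk c p) (view T hk c q)

theorem viewDist_eq_add_one_or (hp : c ≠ p.1) (hq : c ≠ q.1) (hpq : p.1 ≠ q.1) :
    viewDist T hk c p q = viewDist T hk p.1 p q + 1 ∨
      viewDist T hk p.1 p q = viewDist T hk c p q + 1 := by
  have law : ∀ e f g : ZMod 4, (e = 1 ∨ e = -1) → (f = 1 ∨ f = -1) → (g = 1 ∨ g = -1) → ∀ a,
      arc (a + (e - f)) = arc (a + (0 - g)) + 1 ∨ arc (a + (0 - g)) = arc (a + (e - f)) + 1 := by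
    decide
  have := law _ _ _ (T.turn_cast_eq hp) (T.turn_cast_eq hq) (T.turn_cast_eq hpq)
    (angle (two_le_three_mul_sub_one hk) p.2.2 - angle (two_le_three_mul_sub_one hk) q.2.2)
  simp only [viewDist, hammingDist_view, T.turn_self, Int.cast_sub, Int.cast_zero]
  omega

theorem not_triangle_of_pairwise_ne (h₁ : p.1 ≠ q.1) (h₂ : p.1 ≠ r.1) (h₃ : q.1 ≠ r.1)
    (hpq : (twistedGraph T m k hk).Adj p q) (hpr : (twistedGraph T m k hk).Adj p r)
    (hqr : (twistedGraph T m k hk).Adj q r) : False := by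
  obtain ⟨e, he, hek⟩ :=
    exists_perimeter_eq (view T hk p.1 p) (view T hk p.1 q) (view T hk p.1 r)
  rw [twistedGraph_adj_iff_view (.inl rfl), LayeredAdj.iff_outer (by simp [h₁])] at hpq
  rw [twistedGraph_adj_iff_view (.inl rfl), LayeredAdj.iff_outer (by simp [h₂])] at hpr
  rw [twistedGraph_adj_iff_view (.inl rfl), LayeredAdj.iff_outer (by simp [h₃])] at hqr
  have := viewDist_eq_add_one_or (T := T) (hk := hk) h₁ h₂ h₃
  simp only [viewDist, OuterAdj] at this hpq hpr hqr
  omega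

theorem twistedGraph_cliqueFree_three : (twistedGraph T m k hk).CliqueFree 3 := by
  classical
  rintro s hs
  obtain ⟨p, q, r, hpq, hpr, hqr, -⟩ := SimpleGraph.is3Clique_iff.1 hs
  by_cases h : p.1 = q.1 ∨ p.1 = r.1 ∨ q.1 = r.1
  · exact LayeredAdj.not_triangle hk ((twistedGraph_adj_iff_view (.inl rfl)).1 hpq)
      ((twistedGraph_adj_iff_view (.inl rfl)).1 hpr) ((twistedGraph_adj_iff_view h).1 hqr)
  · push Not at h
    exact not_triangle_of_pairwise_ne h.1 h.2.1 h.2.2 hpq hpr hqr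

variable (T hk c) in
/-- The vertex with index `j` over `i` that has position `x` as seen from the part over `c`. -/
noncomputable def ofView (i : V) (j : Fin m) (x : Cube k) : V × Fin m × Cube k :=
  (i, j, (twistPerm (two_le_three_mul_sub_one hk) ^ T.turn c i).symm x)

theorem view_ofView (i : V) (j : Fin m) (x : Cube k) : view T hk c (ofView T hk c i j x) = x :=
  Equiv.apply_symm_apply ..

theorem ofView_view : ofView T hk c p.1 p.2.1 (view T hk c p) = p := by
  rw [ofView, view, Equiv.symm_apply_apply]

variable (T hk) in
/-- The part of the twisted graph over at most two vertices of the tournament, as seen from one of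
them, is an untwisted graph. -/
noncomputable def pairEmbedding {S : Finset V} (hS : S.card ≤ 2) (hc : c ∈ S) :
    (LayeredAdj : (S × Fin m) × Cube k → _ → Prop) ↪r (twistedGraph T m k hk).Adj where
  toFun y := ofView T hk c y.1.1 y.1.2 y.2
  inj' := by
    rintro ⟨⟨i, j⟩, x⟩ ⟨⟨i', j'⟩, x'⟩ h
    obtain ⟨hi, rfl, -⟩ := by simpa only [ofView, Prod.mk.injEq] using h
    obtain rfl := Subtype.ext hi
    have hx := congrArg (view T hk c) h
    rw [view_ofView, view_ofView] at hx
    exact congrArg _ hx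
  map_rel_iff' := by
    rintro ⟨⟨i, j⟩, x⟩ ⟨⟨i', j'⟩, x'⟩
    have hi : c = i.1 ∨ c = i'.1 ∨ i.1 = i'.1 := by
      by_contra! hne
      have := Finset.two_lt_card.2 ⟨c, hc, i, i.2, i', i'.2, hne⟩
      omega
    change (twistedGraph T m k hk).Adj (ofView T hk c i j x) (ofView T hk c i' j' x') ↔ _
    rw [twistedGraph_adj_iff_view hi, view_ofView, view_ofView]
    simp only [LayeredAdj, ofView, ne_eq, Prod.mk.injEq, Subtype.ext_iff]

theorem mem_range_pairEmbedding {S : Finset V} (hS : S.card ≤ 2) (hc : c ∈ S) (hp : p.1 ∈ S) :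
    p ∈ Set.range (pairEmbedding T hk hS hc) :=
  ⟨((⟨p.1, hp⟩, p.2.1), view T hk c p), ofView_view (hk := hk)⟩

theorem realizable_of_card_le_two {S : Finset V} (hS : S.card ≤ 2) (hSm : 4 ≤ S.card * m)
    {s t u : Demand (V × Fin m × Cube k)} (hs : s.point.1 ∈ S) (ht : t.point.1 ∈ S)
    (hu : u.point.1 ∈ S) (hst : s.Consistent (twistedGraph T m k hk).Adj t)
    (hsu : s.Consistent (twistedGraph T m k hk).Adj u)
    (htu : t.Consistent (twistedGraph T m k hk).Adj u) :
    Realizable (twistedGraph T m k hk).Adj s t u := by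
  let f := pairEmbedding (m := m) T hk hS hs
  have exists_map_eq (d : Demand (V × Fin m × Cube k)) (hd : d.point.1 ∈ S) :
      ∃ d' : Demand ((S × Fin m) × Cube k), d'.map f = d := by
    obtain ⟨y, hy⟩ := mem_range_pairEmbedding hS hs hd
    exact ⟨⟨y, d.adj⟩, by rw [Demand.map, hy]⟩
  obtain ⟨s', hs'⟩ := exists_map_eq s hs
  obtain ⟨t', ht'⟩ := exists_map_eq t ht
  obtain ⟨u', hu'⟩ := exists_map_eq u hu
  rw [← hs', ← ht'] at hst
  rw [← hs', ← hu'] at hsu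
  rw [← ht', ← hu'] at htu
  rw [← hs', ← ht', ← hu']
  exact (LayeredAdj.realizable hk (by simpa using hSm) (.of_map f hst) (.of_map f hsu)
    (.of_map f htu)).map f

theorem realizable_of_not_pairwise_ne [Finite V] (hm : 2 ≤ m) (hVm : 4 ≤ Nat.card V * m)
    {s t u : Demand (V × Fin m × Cube k)}
    (h : s.point.1 = t.point.1 ∨ s.point.1 = u.point.1 ∨ t.point.1 = u.point.1)
    (hst : s.Consistent (twistedGraph T m k hk).Adj t)
    (hsu : s.Consistent (twistedGraph T m k hk).Adj u)
    (htu : t.Consistent (twistedGraph T m k hk).Adj u) :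
    Realizable (twistedGraph T m k hk).Adj s t u := by
  classical
  cases nonempty_fintype V
  rw [Nat.card_eq_fintype_card] at hVm
  let P : Finset V := {s.point.1, t.point.1, u.point.1}
  have hP : P.card ≤ 2 := by
    obtain h | h | h := h <;> simp [P, h, Finset.card_le_two]
  obtain ⟨S, hPS, -, hS⟩ := Finset.exists_subsuperset_card_eq (Finset.subset_univ P)
    (n := min 2 (Fintype.card V)) (le_min hP (Finset.card_le_univ P)) (min_le_right _ _)
  have hSm : 4 ≤ S.card * m := by
    rw [hS]
    obtain h | h := min_choice 2 (Fintype.card V) <;> rw [h]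
    · omega
    · exact hVm
  exact realizable_of_card_le_two (hS.trans_le (min_le_left _ _)) hSm (hPS (by simp [P]))
    (hPS (by simp [P])) (hPS (by simp [P])) hst hsu htu

theorem arc_add_two (a : ZMod 4) : arc (a + 2) + arc a = 2 := by
  decide +revert

theorem tailDist_le_viewDist (c : V) (p q : V × Fin m × Cube k) :
    hammingDist (tail p.2.2) (tail q.2.2) ≤ viewDist T hk c p q :=
  (Nat.le_add_left ..).trans_eq (hammingDist_view ..).symm

/-- `T.Splits c a b` if one of the arcs between `c` and `a`, `b` leaves and the other enters `c`. -/
def Tournament.Splits (T : Tournament V) (c a b : V) : Prop :=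
  ¬ (T.Adj c a ↔ T.Adj c b)

theorem Tournament.turn_sub_turn_of_splits_iff {a b c d : V} (hca : c ≠ a) (hcb : c ≠ b)
    (hda : d ≠ a) (hdb : d ≠ b) (h : T.Splits c a b ↔ ¬ T.Splits d a b) :
    ((T.turn d a - T.turn d b : ℤ) : ZMod 4) = (T.turn c a - T.turn c b : ℤ) + 2 := by
  have turn_eq {i j : V} (hij : i ≠ j) :
      T.Adj i j ∧ T.turn i j = 1 ∨ ¬ T.Adj i j ∧ T.turn i j = -1 :=
    (T.adj_or_adj_of_ne hij).imp (fun h => ⟨h, turn_of_adj h⟩)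
      fun h => ⟨(T.exactlyOne j i hij.symm).1 h, turn_of_adj_symm h⟩
  unfold Splits at h
  obtain ⟨h₁, e₁⟩ | ⟨h₁, e₁⟩ := turn_eq hca <;> obtain ⟨h₂, e₂⟩ | ⟨h₂, e₂⟩ := turn_eq hcb <;>
    obtain ⟨h₃, e₃⟩ | ⟨h₃, e₃⟩ := turn_eq hda <;> obtain ⟨h₄, e₄⟩ | ⟨h₄, e₄⟩ := turn_eq hdb <;>
    simp only [h₁, h₂, h₃, h₄, iff_self, not_true_eq_false, not_false_eq_true, iff_true,
      iff_false] at h <;> rw [e₁, e₂, e₃, e₄] <;> decide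

theorem viewDist_add_viewDist_of_splits_iff {d : V} (hcp : c ≠ p.1) (hcq : c ≠ q.1) (hdp : d ≠ p.1)
    (hdq : d ≠ q.1) (h : T.Splits c p.1 q.1 ↔ ¬ T.Splits d p.1 q.1) :
    viewDist T hk d p q + viewDist T hk c p q =
      2 + 2 * hammingDist (tail p.2.2) (tail q.2.2) := by
  rw [viewDist, viewDist, hammingDist_view, hammingDist_view,
    Tournament.turn_sub_turn_of_splits_iff hcp hcq hdp hdq h]
  have := arc_add_two (angle (two_le_three_mul_sub_one hk) p.2.2 -
    angle (two_le_three_mul_sub_one hk) q.2.2 + (T.turn c p.1 - T.turn c q.1 : ℤ))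
  rw [add_assoc] at this
  omega

/-- The hypothesis fixes the parity of the number of pairs that look farther apart from the third
part than from their own. It arises when no pair is compatible as seen from the third part. -/
theorem viewDist_ne_tailDist_add_one (hpq : p.1 ≠ q.1) (hpr : p.1 ≠ r.1) (hqr : q.1 ≠ r.1)
    (h : viewDist T hk r.1 p q = viewDist T hk p.1 p q + 1 ↔
      (viewDist T hk q.1 p r = viewDist T hk p.1 p r + 1 ↔
        viewDist T hk p.1 q r = viewDist T hk q.1 q r + 1)) :
    viewDist T hk r.1 p q ≠ hammingDist (tail p.2.2) (tail q.2.2) + 1 ∧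
      viewDist T hk q.1 p r ≠ hammingDist (tail p.2.2) (tail r.2.2) + 1 ∧
        viewDist T hk p.1 q r ≠ hammingDist (tail q.2.2) (tail r.2.2) + 1 := by
  have law : ∀ e f g : ZMod 4, (e = 1 ∨ e = -1) → (f = 1 ∨ f = -1) → (g = 1 ∨ g = -1) →
      ∀ a b, (arc (a + (-f - -g)) = arc (a + (0 - e)) + 1 ↔
        (arc (a + b + (-e - g)) = arc (a + b + (0 - f)) + 1 ↔
          arc (b + (e - f)) = arc (b + (0 - g)) + 1)) →
      arc (a + (-f - -g)) ≠ 1 ∧ arc (a + b + (-e - g)) ≠ 1 ∧ arc (b + (e - f)) ≠ 1 := by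
    decide
  have := law _ _ _ (T.turn_cast_eq hpq) (T.turn_cast_eq hpr) (T.turn_cast_eq hqr)
    (angle (two_le_three_mul_sub_one hk) p.2.2 - angle (two_le_three_mul_sub_one hk) q.2.2)
    (angle (two_le_three_mul_sub_one hk) q.2.2 - angle (two_le_three_mul_sub_one hk) r.2.2)
  simp only [viewDist, hammingDist_view, T.turn_self, T.turn_symm p.1 q.1, T.turn_symm p.1 r.1,
    T.turn_symm q.1 r.1, Int.cast_sub, Int.cast_neg, Int.cast_zero] at h ⊢
  rw [sub_add_sub_cancel] at this
  omega

section PairOfParts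

variable {d : V} {s t : Demand (V × Fin m × Cube k)}

theorem compatible_view_iff : Compatible (s.map (view T hk c)) (t.map (view T hk c)) ↔
    (s.adj → t.adj → viewDist T hk c s.point t.point + 2 ≤ 2 * k) ∧
      (viewDist T hk c s.point t.point = 0 → (s.adj ↔ t.adj)) := by
  rw [viewDist, hammingDist_eq_zero]
  rfl

theorem viewDist_lt_of_consistent (hne : s.point.1 ≠ t.point.1)
    (hst : s.Consistent (twistedGraph T m k hk).Adj t) (hs : s.adj) (ht : t.adj) :
    viewDist T hk s.point.1 s.point t.point < 2 * k := by
  have hadj := hst.1 hs ht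
  rwa [twistedGraph_adj_iff_view (.inl rfl), LayeredAdj.iff_outer (by simp [hne]), OuterAdj,
    not_le] at hadj

theorem viewDist_eq_add_one_iff_of_not_compatible
    (hs : c ≠ s.point.1) (ht : c ≠ t.point.1) (hne : s.point.1 ≠ t.point.1)
    (hst : s.Consistent (twistedGraph T m k hk).Adj t)
    (h : ¬ Compatible (s.map (view T hk c)) (t.map (view T hk c))) :
    viewDist T hk c s.point t.point = viewDist T hk s.point.1 s.point t.point + 1 ↔
      (s.adj ↔ t.adj) := by
  have hlt := viewDist_lt_of_consistent hne hst
  have hstep := viewDist_eq_add_one_or (T := T) (hk := hk) hs ht hne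
  rw [compatible_view_iff] at h
  by_cases hsa : s.adj <;> by_cases hta : t.adj <;>
    simp only [hsa, hta, forall_const, false_imp_iff, true_and, iff_self, implies_true, and_true,
      not_true_eq_false, iff_true, iff_false] at h hlt ⊢ <;> omega

theorem compatible_view_of_not_compatible_view
    (hcs : c ≠ s.point.1) (hct : c ≠ t.point.1) (hds : d ≠ s.point.1) (hdt : d ≠ t.point.1)
    (hne : s.point.1 ≠ t.point.1)
    (hsplits : T.Splits c s.point.1 t.point.1 ↔ ¬ T.Splits d s.point.1 t.point.1)
    (hst : s.Consistent (twistedGraph T m k hk).Adj t)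
    (h : ¬ Compatible (s.map (view T hk c)) (t.map (view T hk c)))
    (htail : viewDist T hk c s.point t.point ≠
      hammingDist (tail s.point.2.2) (tail t.point.2.2) + 1) :
    Compatible (s.map (view T hk d)) (t.map (view T hk d)) := by
  have hlt := viewDist_lt_of_consistent hne hst
  have hup := viewDist_eq_add_one_iff_of_not_compatible hcs hct hne hst h
  have hsum := viewDist_add_viewDist_of_splits_iff (hk := hk) hcs hct hds hdt hsplits
  have hle₁ := tailDist_le_viewDist (T := T) (hk := hk) s.point.1 s.point t.point
  have hle₂ := tailDist_le_viewDist (T := T) (hk := hk) d s.point t.point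
  rw [compatible_view_iff] at h ⊢
  by_cases hsa : s.adj <;> by_cases hta : t.adj <;>
    simp only [hsa, hta, forall_const, false_imp_iff, true_and, iff_self, implies_true, and_true,
      not_true_eq_false, iff_true, iff_false] at h hlt hup ⊢ <;> omega

end PairOfParts

instance : DecidableRel Tournament.T4.Adj := fun i j =>
  inferInstanceAs (Decidable ((i, j) ∈ (_ : Finset (Fin 4 × Fin 4))))

instance : DecidableRel Tournament.T4'.Adj := fun i j =>
  inferInstanceAs (Decidable (Tournament.T4.Adj j i))

namespace Tournament

/-- Each pair of the vertices `a`, `b`, `c` is split by exactly one of the third of them and `d`. -/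
def Complements (T : Tournament V) (d a b c : V) : Prop :=
  (T.Splits c a b ↔ ¬ T.Splits d a b) ∧ (T.Splits b a c ↔ ¬ T.Splits d a c) ∧
    (T.Splits a b c ↔ ¬ T.Splits d b c)

theorem T4_exists_complements : ∀ a b c : Fin 4, a ≠ b → a ≠ c → b ≠ c →
    ∃ d, d ≠ a ∧ d ≠ b ∧ d ≠ c ∧ T4.Complements d a b c := by
  unfold Complements Splits
  decide

theorem T4'_exists_complements : ∀ a b c : Fin 4, a ≠ b → a ≠ c → b ≠ c →
    ∃ d, d ≠ a ∧ d ≠ b ∧ d ≠ c ∧ T4'.Complements d a b c := by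
  unfold Complements Splits
  decide

theorem IsCopy.complements_iff {W : Type*} {S : Tournament W} {f : W ↪ V} (hf : S.IsCopy T f)
    {d a b c : W} : T.Complements (f d) (f a) (f b) (f c) ↔ S.Complements d a b c := by
  simp only [Complements, Splits, hf _ _]

theorem IsShattered.exists_complements (hT : T.IsShattered) {a b c : V} (hab : a ≠ b) (hac : a ≠ c)
    (hbc : b ≠ c) : ∃ d, d ≠ a ∧ d ≠ b ∧ d ≠ c ∧ T.Complements d a b c := by
  obtain ⟨f, hf, ⟨a, rfl⟩, ⟨b, rfl⟩, ⟨c, rfl⟩⟩ := hT a b c hab hac hbc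
  rw [f.injective.ne_iff] at hab hac hbc
  obtain hf | hf := hf
  · obtain ⟨d, hda, hdb, hdc, hd⟩ := T4_exists_complements a b c hab hac hbc
    exact ⟨f d, f.injective.ne hda, f.injective.ne hdb, f.injective.ne hdc,
      hf.complements_iff.2 hd⟩
  · obtain ⟨d, hda, hdb, hdc, hd⟩ := T4'_exists_complements a b c hab hac hbc
    exact ⟨f d, f.injective.ne hda, f.injective.ne hdb, f.injective.ne hdc,
      hf.complements_iff.2 hd⟩

end Tournament

theorem twistedGraph_adj_iff_outerAdj {i : V} {j : Fin m} {x : Cube k}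
    (h : (i, j) ≠ (q.1, q.2.1)) :
    (twistedGraph T m k hk).Adj (i, j, x) q ↔ OuterAdj x (view T hk i q) :=
  twistedGraph_adj_iff_view_left.trans (LayeredAdj.iff_outer h)

theorem twistedGraph_adj_iff_innerAdj {i : V} {j : Fin m} {x : Cube k}
    (h : (i, j) = (q.1, q.2.1)) :
    (twistedGraph T m k hk).Adj (i, j, x) q ↔ InnerAdj x (view T hk i q) :=
  twistedGraph_adj_iff_view_left.trans (LayeredAdj.iff_inner h)

section Triple

variable {s t u : Demand (V × Fin m × Cube k)}

theorem realizable_of_compatible_view (j : Fin m) (hs : c ≠ s.point.1) (ht : c ≠ t.point.1)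
    (hu : c ≠ u.point.1) (hst : Compatible (s.map (view T hk c)) (t.map (view T hk c)))
    (hsu : Compatible (s.map (view T hk c)) (u.map (view T hk c)))
    (htu : Compatible (t.map (view T hk c)) (u.map (view T hk c))) :
    Realizable (twistedGraph T m k hk).Adj s t u := by
  obtain ⟨v, hvs, hvt, hvu⟩ := realizable_outerAdj_of_compatible hk hst hsu htu
  exact ⟨(c, j, v), (twistedGraph_adj_iff_outerAdj (by simp [hs])).trans hvs,
    (twistedGraph_adj_iff_outerAdj (by simp [ht])).trans hvt,
    (twistedGraph_adj_iff_outerAdj (by simp [hu])).trans hvu⟩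

theorem not_outerAdj_view_of_consistent (hVst : s.point.1 ≠ t.point.1)
    (hst : s.Consistent (twistedGraph T m k hk).Adj t) (hs : s.adj) (ht : t.adj) :
    ¬ OuterAdj (view T hk s.point.1 s.point) (view T hk s.point.1 t.point) :=
  (viewDist_lt_of_consistent hVst hst hs ht).not_ge

theorem realizable_of_compatible_view_left (hm : 2 ≤ m) (hVst : s.point.1 ≠ t.point.1)
    (hVsu : s.point.1 ≠ u.point.1) (hst : s.Consistent (twistedGraph T m k hk).Adj t)
    (hsu : s.Consistent (twistedGraph T m k hk).Adj u)
    (htu : Compatible (t.map (view T hk s.point.1)) (u.map (view T hk s.point.1))) :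
    Realizable (twistedGraph T m k hk).Adj s t u := by
  have : Nontrivial (Fin m) := Fin.nontrivial_iff_two_le.2 hm
  obtain ⟨j, hj⟩ := exists_ne s.point.2.1
  obtain ⟨v, hvs | hvs, hvt, hvu⟩ := exists_meets_inner_or_outer
    (s := s.map (view T hk s.point.1)) (t := t.map (view T hk s.point.1))
    (u := u.map (view T hk s.point.1)) hk (not_outerAdj_view_of_consistent hVst hst)
    (not_outerAdj_view_of_consistent hVsu hsu) htu
  · exact ⟨(s.point.1, s.point.2.1, v), (twistedGraph_adj_iff_innerAdj rfl).trans hvs,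
      (twistedGraph_adj_iff_outerAdj (by simp [hVst])).trans hvt,
      (twistedGraph_adj_iff_outerAdj (by simp [hVsu])).trans hvu⟩
  · exact ⟨(s.point.1, j, v), (twistedGraph_adj_iff_outerAdj (by simp [hj])).trans hvs,
      (twistedGraph_adj_iff_outerAdj (by simp [hVst])).trans hvt,
      (twistedGraph_adj_iff_outerAdj (by simp [hVsu])).trans hvu⟩

theorem exists_compatible_view (hT : T.IsShattered) (hVst : s.point.1 ≠ t.point.1)
    (hVsu : s.point.1 ≠ u.point.1) (hVtu : t.point.1 ≠ u.point.1)
    (hst : s.Consistent (twistedGraph T m k hk).Adj t)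
    (hsu : s.Consistent (twistedGraph T m k hk).Adj u)
    (htu : t.Consistent (twistedGraph T m k hk).Adj u)
    (hnst : ¬ Compatible (s.map (view T hk u.point.1)) (t.map (view T hk u.point.1)))
    (hnsu : ¬ Compatible (s.map (view T hk t.point.1)) (u.map (view T hk t.point.1)))
    (hntu : ¬ Compatible (t.map (view T hk s.point.1)) (u.map (view T hk s.point.1))) :
    ∃ d, d ≠ s.point.1 ∧ d ≠ t.point.1 ∧ d ≠ u.point.1 ∧
      Compatible (s.map (view T hk d)) (t.map (view T hk d)) ∧
        Compatible (s.map (view T hk d)) (u.map (view T hk d)) ∧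
          Compatible (t.map (view T hk d)) (u.map (view T hk d)) := by
  obtain ⟨d, hs, ht, hu, cst, csu, ctu⟩ := hT.exists_complements hVst hVsu hVtu
  have ust := viewDist_eq_add_one_iff_of_not_compatible hVsu.symm hVtu.symm hVst hst hnst
  have usu := viewDist_eq_add_one_iff_of_not_compatible hVst.symm hVtu hVsu hsu hnsu
  have utu := viewDist_eq_add_one_iff_of_not_compatible hVst hVsu hVtu htu hntu
  obtain ⟨tst, tsu, ttu⟩ := viewDist_ne_tailDist_add_one hVst hVsu hVtu
    (by rw [ust, usu, utu]; grind)
  exact ⟨d, hs, ht, hu,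
    compatible_view_of_not_compatible_view hVsu.symm hVtu.symm hs ht hVst cst hst hnst tst,
    compatible_view_of_not_compatible_view hVst.symm hVtu hs hu hVsu csu hsu hnsu tsu,
    compatible_view_of_not_compatible_view hVst hVsu ht hu hVtu ctu htu hntu ttu⟩

theorem realizable_of_pairwise_ne (hT : T.IsShattered) (hm : 2 ≤ m) (hVst : s.point.1 ≠ t.point.1)
    (hVsu : s.point.1 ≠ u.point.1) (hVtu : t.point.1 ≠ u.point.1)
    (hst : s.Consistent (twistedGraph T m k hk).Adj t)
    (hsu : s.Consistent (twistedGraph T m k hk).Adj u)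
    (htu : t.Consistent (twistedGraph T m k hk).Adj u) :
    Realizable (twistedGraph T m k hk).Adj s t u := by
  have : Std.Symm (twistedGraph T m k hk).Adj := (twistedGraph T m k hk).symm
  by_cases cst : Compatible (s.map (view T hk u.point.1)) (t.map (view T hk u.point.1))
  · exact (realizable_of_compatible_view_left hm hVsu.symm hVtu.symm hsu.symm htu.symm cst).rotate
  by_cases csu : Compatible (s.map (view T hk t.point.1)) (u.map (view T hk t.point.1))
  · exact (realizable_of_compatible_view_left hm hVtu hVst.symm htu hst.symm csu.symm).rotate.rotate
  by_cases ctu : Compatible (t.map (view T hk s.point.1)) (u.map (view T hk s.point.1))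
  · exact realizable_of_compatible_view_left hm hVst hVsu hst hsu ctu
  obtain ⟨d, hs, ht, hu, dst, dsu, dtu⟩ :=
    exists_compatible_view hT hVst hVsu hVtu hst hsu htu cst csu ctu
  exact realizable_of_compatible_view s.point.2.1 hs ht hu dst dsu dtu

end Triple

theorem twistedGraph_isExistentiallyComplete_three [Finite V] (hT : T.IsShattered) (hm : 2 ≤ m)
    (hVm : 4 ≤ Nat.card V * m) : (twistedGraph T m k hk).IsExistentiallyComplete 3 := by
  have : Nonempty V := by
    by_contra! hV
    simp at hVm
  have : NeZero m := ⟨by omega⟩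
  refine isExistentiallyComplete_three_of_realizable fun s t u hst hsu htu => ?_
  by_cases h : s.point.1 = t.point.1 ∨ s.point.1 = u.point.1 ∨ t.point.1 = u.point.1
  · exact realizable_of_not_pairwise_ne hm hVm h hst hsu htu
  · push Not at h
    exact realizable_of_pairwise_ne hT hm h.1 h.2.1 h.2.2 hst hsu htu

end TwistedGraph

theorem mainTheorem5 {V : Type*} [Finite V] (T : Tournament V) (hT : T.IsShattered)
    (m k : ℕ) (hm : 2 ≤ m) (hk : 1 ≤ k) (hTm : 4 ≤ Nat.card V * m) :
    (twistedGraph T m k hk).Is3ECTF where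
  finite := inferInstance
  triangleFree := twistedGraph_cliqueFree_three
  existentiallyComplete := twistedGraph_isExistentiallyComplete_three hT hm hTm
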